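/- Let $p$ be a prime, let $K$ be a finite extension of $\mathbf{Q}_p$ with ring of integers $\mathcal{O}_K$ and maximal ideal $\mathfrak{m}_K$ of $\mathcal{O}_K$, and fix an embedding of $K$ into $\mathbf{C}_p$ over $\mathbf{Q}_p$. A series $g(X) \in X \cdot \mathcal{O}_K[[X]]$ is called invertible if $g'(0) \in \mathcal{O}_K^\times$, noninvertible if $g'(0) \in \mathfrak{m}_K$, and stable if $g'(0)$ is neither $0$ nor a root of unity. The roots of a power series over $\mathcal{O}_K$ are its roots in the open unit disk $\{z \in \mathbf{C}_p : |z|_p < 1\}$. For $n \geq 1$, write $f^{\circ n} = f \circ \cdots \circ f$ ($n$ times). Let $f(X) \in X \cdot \mathcal{O}_K[[X]]$ be a noninvertible stable series with $f \not\equiv 0 \bmod \mathfrak{m}_K$, and suppose that there is a stable invertible series $u(X) \in X \cdot \mathcal{O}_K[[X]]$ such that $f \circ u = u \circ f$. Then the roots of $f^{\circ n}$ are simple for all $n \geq 1$ if and only if $f'(X)/f'(0) \in 1 + X \cdot \mathcal{O}_K[[X]]$. -/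

import Mathlib

open PowerSeries

namespace LubinDynamics

section LocalRing

variable (p : ℕ) [Fact p.Prime] (K : Type*) [Field K] [Algebra ℚ_[p] K] [FiniteDimensional ℚ_[p] K]
  [Algebra ℤ_[p] K] [IsScalarTower ℤ_[p] ℚ_[p] K]

/-- The ring of integers `𝒪_K` of a finite extension `K` of `ℚ_p`: the integral closure
of `ℤ_p` in `K`. -/
noncomputable abbrev ringOfIntegers : Subalgebra ℤ_[p] K := integralClosure ℤ_[p] K

variable {K} in
/-- `𝒪_K` is the closed unit ball of the `p`-adic norm of `K`. -/
theorem mem_ringOfIntegers_iff (x : K) :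
    x ∈ ringOfIntegers p K ↔ spectralNorm ℚ_[p] K x ≤ 1 := by
  have hx : IsIntegral ℚ_[p] x := Algebra.IsIntegral.isIntegral x
  rw [spectralNorm, spectralValue_le_one_iff (minpoly.monic hx), ringOfIntegers,
    mem_integralClosure_iff]
  constructor
  · intro h n
    rw [minpoly.isIntegrallyClosed_eq_field_fractions' ℚ_[p] h, Polynomial.coeff_map]
    exact PadicInt.norm_le_one _
  · intro h
    have hl : minpoly ℚ_[p] x ∈ Polynomial.lifts (algebraMap ℤ_[p] ℚ_[p]) := by
      rw [Polynomial.lifts_iff_coeff_lifts]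
      intro n
      exact ⟨⟨_, h n⟩, rfl⟩
    obtain ⟨q, hq, -, hm⟩ := Polynomial.lifts_and_natDegree_eq_and_monic hl (minpoly.monic hx)
    refine ⟨q, hm, ?_⟩
    rw [← Polynomial.aeval_def, ← Polynomial.aeval_map_algebraMap ℚ_[p], hq]
    exact minpoly.aeval _ _

/-- `𝒪_K` is a local ring; its maximal ideal is denoted `𝔪_K`. -/
instance isLocalRing_ringOfIntegers : IsLocalRing (ringOfIntegers p K) := by
  have key : ∀ x : ringOfIntegers p K, x ∈ nonunits (ringOfIntegers p K) ↔
      spectralNorm ℚ_[p] K x.1 < 1 := by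
    intro x
    have hx := (mem_ringOfIntegers_iff p x.1).1 x.2
    have hmul : ∀ a b : K, spectralNorm ℚ_[p] K (a * b) =
        spectralNorm ℚ_[p] K a * spectralNorm ℚ_[p] K b := fun a b =>
      map_mul (spectralMulAlgNorm ℚ_[p] K) a b
    rw [mem_nonunits_iff, ← not_le, not_iff_not]
    constructor
    · intro h
      obtain ⟨y, hy⟩ := h.exists_right_inv
      have h1 : spectralNorm ℚ_[p] K x.1 * spectralNorm ℚ_[p] K y.1 = 1 := by
        rw [← hmul, ← spectralNorm_one (K := ℚ_[p]) (L := K)]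
        exact congrArg _ (congrArg Subtype.val hy)
      have hy1 := (mem_ringOfIntegers_iff p y.1).1 y.2
      have hx0 := spectralNorm_nonneg (K := ℚ_[p]) x.1
      nlinarith
    · intro h
      have hx1 : x.1 ≠ 0 := by
        intro h0
        rw [h0, spectralNorm_zero] at h
        linarith
      have h1 : spectralNorm ℚ_[p] K x.1 * spectralNorm ℚ_[p] K (x.1)⁻¹ = 1 := by
        rw [← hmul, mul_inv_cancel₀ hx1, spectralNorm_one]
      have h2 := spectralNorm_nonneg (K := ℚ_[p]) (x.1)⁻¹
      have h3 : (x.1)⁻¹ ∈ ringOfIntegers p K := by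
        rw [mem_ringOfIntegers_iff]
        nlinarith
      exact IsUnit.of_mul_eq_one ⟨_, h3⟩ (Subtype.ext (mul_inv_cancel₀ hx1))
  refine IsLocalRing.of_nonunits_add fun a b ha hb => ?_
  rw [key] at *
  exact lt_of_le_of_lt (isNonarchimedean_spectralNorm (K := ℚ_[p]) a.1 b.1) (max_lt ha hb)

end LocalRing

section Series

variable {R : Type*} [CommRing R]

/-- `g ∈ X · R⟦X⟧` is invertible if `g'(0)`, its coefficient of `X`, is a unit of `R`. -/
def IsInvertible (g : R⟦X⟧) : Prop :=
  constantCoeff g = 0 ∧ IsUnit (coeff 1 g)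

/-- `g ∈ X · R⟦X⟧` is noninvertible if `g'(0)` lies in the maximal ideal of `R`. -/
def IsNoninvertible [IsLocalRing R] (g : R⟦X⟧) : Prop :=
  constantCoeff g = 0 ∧ coeff 1 g ∈ IsLocalRing.maximalIdeal R

/-- `g` is stable if `g'(0)` is neither `0` nor a root of unity. -/
def IsStable (g : R⟦X⟧) : Prop :=
  coeff 1 g ≠ 0 ∧ ∀ n : ℕ, 1 ≤ n → coeff 1 g ^ n ≠ 1

/-- The composite `f ∘ g = f(g(X))`, for `g` without constant term. -/
noncomputable def comp (f g : R⟦X⟧) : R⟦X⟧ := f.subst g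

/-- The iterate `f^{∘ n}`, with `f^{∘ 0} = X` and `f^{∘ (n + 1)} = f ∘ f^{∘ n}`. -/
noncomputable def iter (f : R⟦X⟧) : ℕ → R⟦X⟧
  | 0 => X
  | n + 1 => comp f (iter f n)

end Series

section Roots

variable {p : ℕ} [Fact p.Prime] {R : Type*} [CommRing R]

/-- The value at `z ∈ ℂ_p` of the series `g`, whose coefficients are mapped to `ℂ_p` by `φ`. If
these are integral, the sum converges for all `z` in the open unit disk. -/
noncomputable def evalAt (φ : R →+* ℂ_[p]) (g : R⟦X⟧) (z : ℂ_[p]) : ℂ_[p] :=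
  ∑' n : ℕ, φ (coeff n g) * z ^ n

/-- `z` is a root of `g`: it lies in the open unit disk of `ℂ_p` and `g(z) = 0`. -/
def IsRoot (φ : R →+* ℂ_[p]) (g : R⟦X⟧) (z : ℂ_[p]) : Prop :=
  ‖z‖ < 1 ∧ evalAt φ g z = 0

/-- All roots of `g` in the open unit disk are simple: `g'` does not vanish at any root of `g`. -/
def HasSimpleRoots (φ : R →+* ℂ_[p]) (g : R⟦X⟧) : Prop :=
  ∀ z : ℂ_[p], IsRoot φ g z → evalAt φ (derivative R g) z ≠ 0

end Roots

end LubinDynamics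

/-! If `f'` is `f'(0)` times a unit, it has no zero in the open disk, and by the chain rule neither
has the derivative of any iterate, so every root is simple.

Conversely, the heart is that every critical point of `f` in the disk is a root of some iterate.
Differentiating `f ∘ u = u ∘ f`, with `u'` a unit, shows that `u` preserves the critical points.
They are finite in number by Weierstrass preparation, so each satisfies `u^j(z) = u^i(z)` with `i <
j`. Stability makes `u^j - u^i` nonzero, so its root set is also finite, and commutation makes it
`f`-stable. As `f` strictly contracts towards `0`, it drives the set into `0`, and `z` becomes a
multiple root of an iterate (`evalAt_derivative_ne_zero_of_hasSimpleRoots`). So simple roots force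
`f'` to have no zeros; preparation then makes it a constant times a unit (`exists_eq_C_mul_isUnit`).
-/

namespace LubinDynamics

/-! ### Evaluation of integral power series on the open unit disk -/

section Evaluation

variable {p : ℕ} [Fact p.Prime] {R : Type*} [CommRing R] {φ : R →+* ℂ_[p]} {z : ℂ_[p]}

theorem norm_term_le (hφ : ∀ x, ‖φ x‖ ≤ 1) (g : R⟦X⟧) (z : ℂ_[p]) (n : ℕ) :
    ‖φ (coeff n g) * z ^ n‖ ≤ ‖z‖ ^ n := by
  rw [norm_mul, norm_pow]
  exact mul_le_of_le_one_left (by positivity) (hφ _)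

theorem summable_norm_term (hφ : ∀ x, ‖φ x‖ ≤ 1) (hz : ‖z‖ < 1) (g : R⟦X⟧) :
    Summable fun n => ‖φ (coeff n g) * z ^ n‖ :=
  .of_nonneg_of_le (fun _ => norm_nonneg _) (norm_term_le hφ g z)
    (summable_geometric_of_lt_one (norm_nonneg _) hz)

theorem summable_term (hφ : ∀ x, ‖φ x‖ ≤ 1) (hz : ‖z‖ < 1) (g : R⟦X⟧) :
    Summable fun n => φ (coeff n g) * z ^ n :=
  (summable_norm_term hφ hz g).of_norm

/-- The values of the polynomials at `z`. -/
theorem evalAt_coe (φ : R →+* ℂ_[p]) (P : Polynomial R) (z : ℂ_[p]) :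
    evalAt φ (P : R⟦X⟧) z = P.eval₂ φ z := by
  rw [evalAt, Polynomial.eval₂_eq_sum_range, tsum_eq_sum (s := Finset.range (P.natDegree + 1))]
  · simp
  · intro n hn
    rw [Polynomial.coeff_coe, Polynomial.coeff_eq_zero_of_natDegree_lt (by simpa using hn)]
    simp

/-- Evaluation at a point of the open unit disk, as a ring homomorphism. -/
noncomputable def evalHom (hφ : ∀ x, ‖φ x‖ ≤ 1) (hz : ‖z‖ < 1) : R⟦X⟧ →+* ℂ_[p] where
  toFun g := evalAt φ g z
  map_one' := by simpa using evalAt_coe φ 1 z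
  map_zero' := by simpa using evalAt_coe φ 0 z
  map_add' g h := by
    simp only [evalAt, map_add, add_mul]
    exact (summable_term hφ hz g).tsum_add (summable_term hφ hz h)
  map_mul' g h := by
    simp only [evalAt]
    rw [tsum_mul_tsum_eq_tsum_sum_antidiagonal_of_summable_norm (summable_norm_term hφ hz g)
      (summable_norm_term hφ hz h)]
    refine tsum_congr fun n => ?_
    rw [coeff_mul, map_sum, Finset.sum_mul]
    refine Finset.sum_congr rfl fun ij hij => ?_
    rw [← Finset.HasAntidiagonal.mem_antidiagonal.1 hij, map_mul, pow_add]
    ring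

theorem evalHom_apply (hφ : ∀ x, ‖φ x‖ ≤ 1) (hz : ‖z‖ < 1) (g : R⟦X⟧) :
    evalHom hφ hz g = evalAt φ g z := rfl

theorem evalAt_mul (hφ : ∀ x, ‖φ x‖ ≤ 1) (hz : ‖z‖ < 1) (g h : R⟦X⟧) :
    evalAt φ (g * h) z = evalAt φ g z * evalAt φ h z := map_mul (evalHom hφ hz) g h

theorem evalAt_add (hφ : ∀ x, ‖φ x‖ ≤ 1) (hz : ‖z‖ < 1) (g h : R⟦X⟧) :
    evalAt φ (g + h) z = evalAt φ g z + evalAt φ h z := map_add (evalHom hφ hz) g h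

theorem evalAt_sub (hφ : ∀ x, ‖φ x‖ ≤ 1) (hz : ‖z‖ < 1) (g h : R⟦X⟧) :
    evalAt φ (g - h) z = evalAt φ g z - evalAt φ h z := map_sub (evalHom hφ hz) g h

theorem evalAt_one (φ : R →+* ℂ_[p]) (z : ℂ_[p]) : evalAt φ (1 : R⟦X⟧) z = 1 := by
  simpa using evalAt_coe φ 1 z

theorem evalAt_X (φ : R →+* ℂ_[p]) (z : ℂ_[p]) : evalAt φ (X : R⟦X⟧) z = z := by
  simpa using evalAt_coe φ Polynomial.X z

theorem evalAt_C (φ : R →+* ℂ_[p]) (a : R) (z : ℂ_[p]) : evalAt φ (C a : R⟦X⟧) z = φ a := by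
  simpa using evalAt_coe φ (Polynomial.C a) z

theorem norm_evalAt_le_one (hφ : ∀ x, ‖φ x‖ ≤ 1) (hz : ‖z‖ < 1) (g : R⟦X⟧) :
    ‖evalAt φ g z‖ ≤ 1 :=
  IsUltrametricDist.norm_tsum_le_of_forall_le_of_nonneg zero_le_one fun n =>
    (norm_term_le hφ g z n).trans (pow_le_one₀ (norm_nonneg _) hz.le)

theorem evalAt_eq_add_mul (hφ : ∀ x, ‖φ x‖ ≤ 1) (hz : ‖z‖ < 1) (g : R⟦X⟧) :
    ∃ w : ℂ_[p], ‖w‖ ≤ 1 ∧ evalAt φ g z = φ (constantCoeff g) + z * w := by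
  refine ⟨_, norm_evalAt_le_one hφ hz (mk fun n => coeff (n + 1) g), ?_⟩
  conv_lhs => rw [eq_X_mul_shift_add_const g, evalAt_add hφ hz, evalAt_mul hφ hz, evalAt_X,
    evalAt_C]
  rw [add_comm]

theorem evalAt_of_constantCoeff_eq_zero (hφ : ∀ x, ‖φ x‖ ≤ 1) (hz : ‖z‖ < 1) {g : R⟦X⟧}
    (hg : constantCoeff g = 0) :
    ∃ h : R⟦X⟧, constantCoeff h = coeff 1 g ∧ evalAt φ g z = z * evalAt φ h z := by
  obtain ⟨h, rfl⟩ := X_dvd_iff.2 hg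
  exact ⟨h, by simp, by rw [evalAt_mul hφ hz, evalAt_X]⟩

theorem norm_evalAt_le (hφ : ∀ x, ‖φ x‖ ≤ 1) (hz : ‖z‖ < 1) {g : R⟦X⟧}
    (hg : constantCoeff g = 0) : ‖evalAt φ g z‖ ≤ ‖z‖ := by
  obtain ⟨h, -, e⟩ := evalAt_of_constantCoeff_eq_zero hφ hz hg
  rw [e, norm_mul]
  exact mul_le_of_le_one_right (norm_nonneg _) (norm_evalAt_le_one hφ hz h)

theorem norm_evalAt_lt_one (hφ : ∀ x, ‖φ x‖ ≤ 1) (hz : ‖z‖ < 1) {g : R⟦X⟧}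
    (hg : ‖φ (constantCoeff g)‖ < 1) : ‖evalAt φ g z‖ < 1 := by
  obtain ⟨w, hw, e⟩ := evalAt_eq_add_mul hφ hz g
  rw [e]
  refine (IsUltrametricDist.norm_add_le_max _ _).trans_lt (max_lt hg ?_)
  rw [norm_mul]
  exact (mul_le_of_le_one_right (norm_nonneg _) hw).trans_lt hz

theorem evalAt_ne_zero_of_isUnit (hφ : ∀ x, ‖φ x‖ ≤ 1) (hz : ‖z‖ < 1) {g : R⟦X⟧}
    (hg : IsUnit g) : evalAt φ g z ≠ 0 :=
  (hg.map (evalHom hφ hz)).ne_zero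

/-- Truncation at order `n` avoids rearranging a double series: ring homomorphisms respect the
polynomial part, and the two remainders differ by at most `‖w‖ ^ n`, which tends to `0`. -/
theorem evalAt_comp (hφ : ∀ x, ‖φ x‖ ≤ 1) (hz : ‖z‖ < 1) (f : R⟦X⟧) {g : R⟦X⟧}
    (hg : constantCoeff g = 0) : evalAt φ (comp f g) z = evalAt φ f (evalAt φ g z) := by
  have hs : HasSubst g := HasSubst.of_constantCoeff_zero' hg
  have hw := (norm_evalAt_le hφ hz hg).trans_lt hz
  set w := evalAt φ g z with hwdef
  have key : ∀ n, ‖evalAt φ (comp f g) z - evalAt φ f w‖ ≤ ‖w‖ ^ n := by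
    intro n
    have e := eq_X_pow_mul_shift_add_trunc n f
    set q : R⟦X⟧ := mk fun i => coeff (i + n) f
    have e1 : evalAt φ (comp f g) z =
        w ^ n * evalAt φ (comp q g) z + (trunc n f).eval₂ φ w := by
      have : comp f g = g ^ n * comp q g + Polynomial.aeval g (trunc n f) := by
        conv_lhs => rw [comp, e, subst_add hs, subst_mul hs, subst_pow hs, subst_X hs, subst_coe hs]
        rfl
      rw [this, ← evalHom_apply hφ hz, map_add, map_mul, map_pow]
      congr 1
      rw [Polynomial.aeval_def, Polynomial.hom_eval₂]
      congr 1
      ext a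
      exact evalAt_C φ a z
    have e2 : evalAt φ f w = w ^ n * evalAt φ q w + (trunc n f).eval₂ φ w := by
      conv_lhs => rw [e]
      rw [← evalHom_apply hφ hw, map_add, map_mul, map_pow, evalHom_apply, evalHom_apply,
        evalHom_apply, evalAt_X, evalAt_coe]
    rw [e1, e2, add_sub_add_right_eq_sub, ← mul_sub, norm_mul, norm_pow]
    refine mul_le_of_le_one_right (by positivity) ?_
    rw [sub_eq_add_neg]
    refine (IsUltrametricDist.norm_add_le_max _ _).trans (max_le (norm_evalAt_le_one hφ hz _) ?_)
    rw [norm_neg]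
    exact norm_evalAt_le_one hφ hw _
  have := ge_of_tendsto' (tendsto_pow_atTop_nhds_zero_of_lt_one (norm_nonneg w) hw) key
  rwa [norm_le_zero_iff, sub_eq_zero] at this

end Evaluation

/-! ### Iterates, their derivatives and contraction -/

section Iterates

variable {R : Type*} [CommRing R]

theorem constantCoeff_comp (f : R⟦X⟧) {g : R⟦X⟧} (hg : constantCoeff g = 0) :
    constantCoeff (comp f g) = constantCoeff f := by
  have hs : HasSubst g := HasSubst.of_constantCoeff_zero' hg
  have e := eq_X_mul_shift_add_const f
  conv_lhs => rw [comp, e, subst_add hs, subst_mul hs, subst_X hs, map_add, map_mul, hg, zero_mul,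
    zero_add, subst_C]
  rfl

theorem derivative_comp (f : R⟦X⟧) {g : R⟦X⟧} (hg : constantCoeff g = 0) :
    derivative R (comp f g) = comp (derivative R f) g * derivative R g :=
  derivative_subst (HasSubst.of_constantCoeff_zero' hg)

theorem constantCoeff_derivative (f : R⟦X⟧) : constantCoeff (derivative R f) = coeff 1 f := by
  rw [← coeff_zero_eq_constantCoeff_apply, coeff_derivative]
  simp

theorem constantCoeff_iter {f : R⟦X⟧} (hf : constantCoeff f = 0) (n : ℕ) :
    constantCoeff (iter f n) = 0 := by
  induction n with
  | zero => simp [iter]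
  | succ n ih => rw [iter, constantCoeff_comp f ih, hf]

theorem coeff_one_iter {f : R⟦X⟧} (hf : constantCoeff f = 0) (n : ℕ) :
    coeff 1 (iter f n) = coeff 1 f ^ n := by
  induction n with
  | zero => simp [iter]
  | succ n ih =>
    have h0 := constantCoeff_iter hf n
    rw [iter, ← constantCoeff_derivative, derivative_comp f h0, map_mul, constantCoeff_comp _ h0,
      constantCoeff_derivative, constantCoeff_derivative, ih, pow_succ']

variable {p : ℕ} [Fact p.Prime] {φ : R →+* ℂ_[p]} {z : ℂ_[p]}

theorem norm_iterate_evalAt_lt_one (hφ : ∀ x, ‖φ x‖ ≤ 1) (hz : ‖z‖ < 1) {f : R⟦X⟧}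
    (hf : constantCoeff f = 0) (n : ℕ) : ‖(evalAt φ f)^[n] z‖ < 1 := by
  induction n with
  | zero => exact hz
  | succ n ih =>
    rw [Function.iterate_succ_apply']
    exact (norm_evalAt_le hφ ih hf).trans_lt ih

theorem evalAt_iter (hφ : ∀ x, ‖φ x‖ ≤ 1) (hz : ‖z‖ < 1) {f : R⟦X⟧}
    (hf : constantCoeff f = 0) (n : ℕ) : evalAt φ (iter f n) z = (evalAt φ f)^[n] z := by
  induction n with
  | zero => exact evalAt_X φ z
  | succ n ih =>
    rw [iter, evalAt_comp hφ hz f (constantCoeff_iter hf n), ih, Function.iterate_succ_apply']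

theorem evalAt_derivative_iter_succ (hφ : ∀ x, ‖φ x‖ ≤ 1) (hz : ‖z‖ < 1) {f : R⟦X⟧}
    (hf : constantCoeff f = 0) (n : ℕ) :
    evalAt φ (derivative R (iter f (n + 1))) z =
      evalAt φ (derivative R f) ((evalAt φ f)^[n] z) * evalAt φ (derivative R (iter f n)) z := by
  rw [iter, derivative_comp f (constantCoeff_iter hf n), evalAt_mul hφ hz,
    evalAt_comp hφ hz _ (constantCoeff_iter hf n), evalAt_iter hφ hz hf]

theorem evalAt_derivative_X (z : ℂ_[p]) : evalAt φ (derivative R (X : R⟦X⟧)) z = 1 := by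
  rw [show derivative R (X : R⟦X⟧) = 1 from derivative_X, evalAt_one]

/-- If `f'` has no zero in the open unit disk, then neither has the derivative of any iterate. -/
theorem evalAt_derivative_iter_ne_zero (hφ : ∀ x, ‖φ x‖ ≤ 1) {f : R⟦X⟧}
    (hf : constantCoeff f = 0) (h : ∀ z : ℂ_[p], ‖z‖ < 1 → evalAt φ (derivative R f) z ≠ 0)
    (hz : ‖z‖ < 1) (n : ℕ) : evalAt φ (derivative R (iter f n)) z ≠ 0 := by
  induction n with
  | zero => rw [iter, evalAt_derivative_X]; exact one_ne_zero
  | succ n ih =>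
    rw [evalAt_derivative_iter_succ hφ hz hf]
    exact mul_ne_zero (h _ (norm_iterate_evalAt_lt_one hφ hz hf n)) ih

/-- A critical point of `f` is a critical point of all its iterates. -/
theorem evalAt_derivative_iter_eq_zero (hφ : ∀ x, ‖φ x‖ ≤ 1) {f : R⟦X⟧}
    (hf : constantCoeff f = 0) (hz : ‖z‖ < 1) (h : evalAt φ (derivative R f) z = 0) (n : ℕ) :
    evalAt φ (derivative R (iter f (n + 1))) z = 0 := by
  induction n with
  | zero => rw [evalAt_derivative_iter_succ hφ hz hf, Function.iterate_zero_apply, h, zero_mul]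
  | succ n ih => rw [evalAt_derivative_iter_succ hφ hz hf, ih, mul_zero]

/-- A noninvertible series contracts the open unit disk towards `0`. -/
theorem norm_evalAt_lt (hφ : ∀ x, ‖φ x‖ ≤ 1) (hz : ‖z‖ < 1) (hz0 : z ≠ 0) {f : R⟦X⟧}
    (hf : constantCoeff f = 0) (hf1 : ‖φ (coeff 1 f)‖ < 1) : ‖evalAt φ f z‖ < ‖z‖ := by
  obtain ⟨h, h1, e⟩ := evalAt_of_constantCoeff_eq_zero hφ hz hf
  rw [e, norm_mul]
  exact mul_lt_of_lt_one_right (norm_pos_iff.2 hz0) (norm_evalAt_lt_one hφ hz (h1 ▸ hf1))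

/-- A finite set of points of the open unit disk that is stable under a noninvertible series
consists of roots of iterates of that series. -/
theorem exists_iterate_evalAt_eq_zero (hφ : ∀ x, ‖φ x‖ ≤ 1) {f : R⟦X⟧}
    (hf : constantCoeff f = 0) (hf1 : ‖φ (coeff 1 f)‖ < 1) {S : Set ℂ_[p]} (hS : S.Finite)
    (hS1 : ∀ z ∈ S, ‖z‖ < 1) (hfS : Set.MapsTo (evalAt φ f) S S) (hz : z ∈ S) :
    ∃ n, (evalAt φ f)^[n] z = 0 := by
  by_contra! h
  have hmem : ∀ n, (evalAt φ f)^[n] z ∈ S := fun n => hfS.iterate n hz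
  -- An orbit avoiding `0` has strictly decreasing norms, hence infinitely many points.
  have hanti : StrictAnti fun n => ‖(evalAt φ f)^[n] z‖ := by
    refine strictAnti_nat_of_succ_lt fun n => ?_
    rw [Function.iterate_succ_apply']
    exact norm_evalAt_lt hφ (hS1 _ (hmem n)) (h n) hf hf1
  exact Set.infinite_of_injective_forall_mem (Function.Injective.of_comp (f := norm)
    hanti.injective) hmem hS

end Iterates

/-! ### Norm and completeness of the ring of integers -/

section RingOfIntegers

variable (p : ℕ) [Fact p.Prime] (K : Type*) [Field K] [Algebra ℚ_[p] K] [FiniteDimensional ℚ_[p] K]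
  [Algebra ℤ_[p] K] [IsScalarTower ℤ_[p] ℚ_[p] K]

-- The `p`-adic norm extends uniquely to `K`, so every embedding induces the spectral norm.
variable {K} in
omit [Algebra ℤ_[p] K] [IsScalarTower ℤ_[p] ℚ_[p] K] in
theorem norm_embedding (ι : K →ₐ[ℚ_[p]] ℂ_[p]) (x : K) :
    ‖ι x‖ = spectralNorm ℚ_[p] K x := by
  let F : AbsoluteValue K ℝ := (NormedField.toAbsoluteValue ℂ_[p]).comp (f := (ι : K →+* ℂ_[p])) ι.injective
  refine spectralNorm_unique_field_norm_ext (K := ℚ_[p]) (f := F) (fun x => ?_) x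
  change ‖ι (algebraMap _ _ x)‖ = _
  rw [ι.commutes]
  exact PadicComplex.norm_extends' p x

instance isNoetherianRing_ringOfIntegers : IsNoetherianRing (ringOfIntegers p K) :=
  IsIntegralClosure.isNoetherianRing ℤ_[p] ℚ_[p] K _

instance isPrincipalIdealRing_ringOfIntegers : IsPrincipalIdealRing (ringOfIntegers p K) := by
  have : IsDedekindDomain (ringOfIntegers p K) :=
    IsIntegralClosure.isDedekindDomain ℤ_[p] ℚ_[p] K _
  infer_instance

/-- The ring is the closed unit ball of a locally compact field, hence compact. Powers of the
maximal ideal are closed, so the nested cosets of a Cauchy sequence have a common point, its limit.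
-/
instance isAdicComplete_ringOfIntegers :
    IsAdicComplete (IsLocalRing.maximalIdeal (ringOfIntegers p K)) (ringOfIntegers p K) := by
  let : NormedField K := spectralNorm.normedField ℚ_[p] K
  let : NormedAlgebra ℚ_[p] K := spectralNorm.normedAlgebra ℚ_[p] K
  have : ProperSpace K := FiniteDimensional.proper ℚ_[p] K
  have hball : ((ringOfIntegers p K : Subalgebra ℤ_[p] K) : Set K) = Metric.closedBall 0 1 := by
    ext x
    rw [mem_closedBall_zero_iff]
    exact mem_ringOfIntegers_iff p x
  have : CompactSpace (ringOfIntegers p K) := by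
    refine (isCompact_iff_compactSpace (s := ((ringOfIntegers p K : Subalgebra ℤ_[p] K) : Set K))).1 ?_
    rw [hball]
    exact isCompact_closedBall _ _
  refine { prec' := fun f hf => ?_ }
  set m := IsLocalRing.maximalIdeal (ringOfIntegers p K)
  let S : ℕ → Set (ringOfIntegers p K) := fun n => {x | x - f n ∈ m ^ n}
  have hS : ∀ n, S (n + 1) ⊆ S n := by
    intro n x hx
    have h1 : f n - f (n + 1) ∈ m ^ n := by simpa [SModEq.sub_mem] using hf n.le_succ
    have h2 := sub_mem (Ideal.pow_le_pow_right n.le_succ hx) h1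
    rwa [sub_sub_sub_cancel_right] at h2
  have hc : ∀ n, IsClosed (S n) := fun n =>
    (IsNoetherianRing.isClosed_ideal (m ^ n)).preimage (continuous_id.sub continuous_const)
  obtain ⟨L, hL⟩ := (hc 0).isCompact.nonempty_iInter_of_sequence_nonempty_isCompact_isClosed S hS
    (fun n => ⟨f n, by simp [S]⟩) hc
  refine ⟨L, fun n => ?_⟩
  have h := Set.mem_iInter.1 hL n
  rw [SModEq.sub_mem, ← neg_mem_iff]
  simpa [S] using h

end RingOfIntegers

/-! ### Weierstrass preparation and zeros in the disk -/

section Weierstrass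

variable {R : Type*} [CommRing R] [IsLocalRing R]

/-- Over a local principal ideal domain, a nonzero series is a constant times a series with
nonzero reduction. -/
theorem exists_eq_C_mul_map_residue_ne_zero [IsDomain R] [IsPrincipalIdealRing R] {g : R⟦X⟧}
    (hg : g ≠ 0) : ∃ (a : R) (h : R⟦X⟧), a ≠ 0 ∧ g = C a * h ∧
      PowerSeries.map (IsLocalRing.residue R) h ≠ 0 := by
  obtain ⟨a, ha⟩ := IsPrincipalIdealRing.principal (Ideal.span (Set.range fun n => coeff n g))
  have hdvd : ∀ n, a ∣ coeff n g := fun n => by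
    rw [← Ideal.mem_span_singleton, ← Ideal.submodule_span_eq, ← ha]
    exact Ideal.subset_span ⟨n, rfl⟩
  choose b hb using hdvd
  have hg' : g = C a * mk b := by
    ext n
    rw [coeff_C_mul, coeff_mk, hb]
  have ha0 : a ≠ 0 := by
    rintro rfl
    exact hg (by rw [hg', map_zero, zero_mul])
  refine ⟨a, mk b, ha0, hg', fun h => ?_⟩
  have hbm : ∀ n, b n ∈ IsLocalRing.maximalIdeal R := fun n => by
    have := congrArg (coeff n) h
    rwa [coeff_map, coeff_mk, map_zero, IsLocalRing.residue_eq_zero_iff] at this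
  -- If `mk b` reduced to zero, the content ideal `(a)` would lie in `(a)𝔪`, forcing `1 ∈ 𝔪`.
  have hle : Ideal.span (Set.range fun n => coeff n g) ≤
      Ideal.span {a} * IsLocalRing.maximalIdeal R := by
    rw [Ideal.span_le]
    rintro _ ⟨n, rfl⟩
    exact Ideal.mem_span_singleton_mul.2 ⟨b n, hbm n, (hb n).symm⟩
  rw [ha] at hle
  obtain ⟨c, hc, hac⟩ := Ideal.mem_span_singleton_mul.1 (hle (Submodule.mem_span_singleton_self a))
  have hc1 : c = 1 := mul_left_cancel₀ ha0 (by rw [hac, mul_one])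
  exact (IsLocalRing.maximalIdeal.isMaximal R).ne_top ((Ideal.eq_top_iff_one _).2 (hc1 ▸ hc))

/-- Weierstrass preparation over a complete local principal ideal domain. -/
theorem exists_eq_C_mul_distinguished_mul_unit [IsDomain R] [IsPrincipalIdealRing R]
    [IsAdicComplete (IsLocalRing.maximalIdeal R) R] {g : R⟦X⟧} (hg : g ≠ 0) :
    ∃ (a : R) (P : Polynomial R) (v : R⟦X⟧), a ≠ 0 ∧
      P.IsDistinguishedAt (IsLocalRing.maximalIdeal R) ∧ IsUnit v ∧ g = C a * (P * v) := by
  obtain ⟨a, h, ha, rfl, hh⟩ := exists_eq_C_mul_map_residue_ne_zero hg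
  obtain ⟨P, v, H⟩ := exists_isWeierstrassFactorization hh
  exact ⟨a, P, v, ha, H.isDistinguishedAt, H.isUnit, by rw [← H.eq_mul]⟩

variable {p : ℕ} [Fact p.Prime] {φ : R →+* ℂ_[p]}

/-- The roots of a distinguished polynomial lie in the open unit disk. -/
theorem norm_lt_one_of_isDistinguishedAt
    (hφm : ∀ x ∈ IsLocalRing.maximalIdeal R, ‖φ x‖ < 1) {P : Polynomial R}
    (hP : P.IsDistinguishedAt (IsLocalRing.maximalIdeal R)) {z : ℂ_[p]}
    (hz : P.eval₂ φ z = 0) : ‖z‖ < 1 := by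
  by_contra! h
  have h0 : 0 < ‖z‖ := one_pos.trans_le h
  rw [Polynomial.eval₂_eq_sum_range, Finset.sum_range_succ, hP.monic.coeff_natDegree, map_one,
    one_mul, add_comm, add_eq_zero_iff_eq_neg] at hz
  -- When `‖z‖ ≥ 1`, the leading term strictly dominates all the others.
  have hlt : ‖∑ i ∈ Finset.range P.natDegree, φ (P.coeff i) * z ^ i‖ < ‖z‖ ^ P.natDegree := by
    refine Finset.sum_induction _ (fun w : ℂ_[p] => ‖w‖ < ‖z‖ ^ P.natDegree)
      (fun a b ha hb => (IsUltrametricDist.norm_add_le_max a b).trans_lt (max_lt ha hb))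
      (by rw [norm_zero]; exact pow_pos h0 _) fun i hi => ?_
    have hi := Finset.mem_range.1 hi
    rw [norm_mul, norm_pow]
    exact (mul_lt_of_lt_one_left (pow_pos h0 _) (hφm _ (hP.mem hi))).trans_le
      (pow_le_pow_right₀ h hi.le)
  rw [← norm_neg, ← hz, norm_pow] at hlt
  exact lt_irrefl _ hlt

variable [IsDomain R] [IsPrincipalIdealRing R] [IsAdicComplete (IsLocalRing.maximalIdeal R) R]

/-- A nonzero series has finitely many roots. -/
theorem finite_setOf_isRoot (hφ : ∀ x, ‖φ x‖ ≤ 1) (hinj : Function.Injective φ) {g : R⟦X⟧}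
    (hg : g ≠ 0) : {z | IsRoot φ g z}.Finite := by
  obtain ⟨a, P, v, ha, hP, hv, rfl⟩ := exists_eq_C_mul_distinguished_mul_unit hg
  have hP0 : P.map φ ≠ 0 := (hP.monic.map φ).ne_zero
  refine (Polynomial.finite_setOfPred_isRoot hP0).subset ?_
  rintro z ⟨hz, h⟩
  rw [evalAt_mul hφ hz, evalAt_mul hφ hz, evalAt_C, evalAt_coe] at h
  have h1 := evalAt_ne_zero_of_isUnit hφ hz hv
  have h2 : φ a ≠ 0 := (map_ne_zero_iff φ hinj).2 ha
  rw [Set.mem_ofPred_eq, Polynomial.IsRoot, Polynomial.eval_map]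
  simpa [h1, h2] using h

/-- A nonzero series without roots is a constant times a unit. -/
theorem exists_eq_C_mul_isUnit (hφ : ∀ x, ‖φ x‖ ≤ 1)
    (hφm : ∀ x ∈ IsLocalRing.maximalIdeal R, ‖φ x‖ < 1) {g : R⟦X⟧} (hg : g ≠ 0)
    (h : ∀ z : ℂ_[p], ‖z‖ < 1 → evalAt φ g z ≠ 0) :
    ∃ (a : R) (v : R⟦X⟧), IsUnit v ∧ g = C a * v := by
  obtain ⟨a, P, v, -, hP, hv, rfl⟩ := exists_eq_C_mul_distinguished_mul_unit hg
  by_cases hd : P.natDegree = 0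
  · refine ⟨a, v, hv, ?_⟩
    rw [hP.monic.natDegree_eq_zero.1 hd, Polynomial.coe_one, one_mul]
  · obtain ⟨z, hz⟩ := IsAlgClosed.exists_root (P.map φ) (by
      rw [hP.monic.degree_map, Polynomial.degree_eq_natDegree hP.monic.ne_zero]
      exact_mod_cast hd)
    rw [Polynomial.IsRoot, Polynomial.eval_map] at hz
    have hz1 := norm_lt_one_of_isDistinguishedAt hφm hP hz
    refine absurd ?_ (h z hz1)
    rw [evalAt_mul hφ hz1, evalAt_mul hφ hz1, evalAt_coe, hz, zero_mul, mul_zero]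

end Weierstrass

/-! ### Critical points of a series commuting with a stable one -/

section Commuting

variable {p : ℕ} [Fact p.Prime] {R : Type*} [CommRing R] [IsLocalRing R] {φ : R →+* ℂ_[p]}
  [IsDomain R] [IsPrincipalIdealRing R] [IsAdicComplete (IsLocalRing.maximalIdeal R) R]

/-- If `f` commutes with a stable invertible series and the roots of all its iterates are simple,
then `f` has no critical point in the open unit disk. -/
theorem evalAt_derivative_ne_zero_of_hasSimpleRoots (hφ : ∀ x, ‖φ x‖ ≤ 1)
    (hinj : Function.Injective φ) {f u : R⟦X⟧} (hf : constantCoeff f = 0)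
    (hf1 : ‖φ (coeff 1 f)‖ < 1) (hfs : coeff 1 f ≠ 0) (hu : IsInvertible u) (hus : IsStable u)
    (hfu : comp f u = comp u f) (hsimple : ∀ n, 1 ≤ n → HasSimpleRoots φ (iter f n))
    {z : ℂ_[p]} (hz : ‖z‖ < 1) : evalAt φ (derivative R f) z ≠ 0 := by
  intro hcrit
  have hdf : derivative R f ≠ 0 := fun h => hfs (by rw [← constantCoeff_derivative, h, map_zero])
  have hcomm : ∀ w : ℂ_[p], ‖w‖ < 1 →
      evalAt φ f (evalAt φ u w) = evalAt φ u (evalAt φ f w) := fun w hw => by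
    rw [← evalAt_comp hφ hw f hu.1, ← evalAt_comp hφ hw u hf, hfu]
  have hcrit_u : Set.MapsTo (evalAt φ u) {w | IsRoot φ (derivative R f) w}
      {w | IsRoot φ (derivative R f) w} := by
    rintro w ⟨hw, hw0⟩
    refine ⟨(norm_evalAt_le hφ hw hu.1).trans_lt hw, ?_⟩
    -- At a critical point `w` the chain rule gives `f'(u(w)) u'(w) = u'(f(w)) f'(w) = 0`.
    have h := congrArg (fun g => evalAt φ (derivative R g) w) hfu
    simp only [derivative_comp f hu.1, derivative_comp u hf, evalAt_mul hφ hw,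
      evalAt_comp hφ hw _ hu.1, hw0, mul_zero] at h
    have hu' : IsUnit (derivative R u) := by
      rw [isUnit_iff_constantCoeff, constantCoeff_derivative]
      exact hu.2
    exact (mul_eq_zero.1 h).resolve_right (evalAt_ne_zero_of_isUnit hφ hw hu')
  obtain ⟨i, j, hij, heq⟩ := (finite_setOf_isRoot hφ hinj hdf).exists_lt_map_eq_of_forall_mem
    (f := fun n => (evalAt φ u)^[n] z) fun n => hcrit_u.iterate n ⟨hz, hcrit⟩
  -- The linear coefficients `u'(0)^j` and `u'(0)^i` differ, as `u'(0)` is neither zero nor a root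
  -- of unity.
  have hdiff : iter u j - iter u i ≠ 0 := by
    intro h
    have h1 := congrArg (coeff 1) h
    rw [map_sub, coeff_one_iter hu.1, coeff_one_iter hu.1, map_zero, sub_eq_zero,
      ← Nat.sub_add_cancel hij.le, pow_add] at h1
    exact hus.2 (j - i) (by omega) (mul_eq_right₀ (pow_ne_zero i hus.1) |>.1 h1)
  have hroot : ∀ w : ℂ_[p], IsRoot φ (iter u j - iter u i) w ↔
      ‖w‖ < 1 ∧ (evalAt φ u)^[j] w = (evalAt φ u)^[i] w := fun w => by
    refine and_congr_right fun hw => ?_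
    rw [evalAt_sub hφ hw, evalAt_iter hφ hw hu.1, evalAt_iter hφ hw hu.1, sub_eq_zero]
  have hcomm_iter : ∀ (n : ℕ) (w : ℂ_[p]), ‖w‖ < 1 →
      evalAt φ f ((evalAt φ u)^[n] w) = (evalAt φ u)^[n] (evalAt φ f w) := fun n w hw => by
    induction n with
    | zero => rfl
    | succ n ih =>
      rw [Function.iterate_succ_apply', Function.iterate_succ_apply',
        hcomm _ (norm_iterate_evalAt_lt_one hφ hw hu.1 n), ih]
  obtain ⟨n, hn⟩ := exists_iterate_evalAt_eq_zero hφ hf hf1 (finite_setOf_isRoot hφ hinj hdiff)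
    (fun w hw => hw.1) (fun w hw => (hroot _).2
      ⟨(norm_evalAt_le hφ hw.1 hf).trans_lt hw.1, by
        rw [← hcomm_iter j w hw.1, ← hcomm_iter i w hw.1, ((hroot w).1 hw).2]⟩)
    ((hroot z).2 ⟨hz, heq.symm⟩)
  have hf0 : evalAt φ f 0 = 0 := norm_le_zero_iff.1
    ((norm_evalAt_le hφ (by simp) hf).trans_eq norm_zero)
  -- One further application of `f` keeps the value `0` and ensures a positive iterate even when `n
  -- = 0`.
  refine hsimple (n + 1) (by omega) z ⟨hz, ?_⟩ (evalAt_derivative_iter_eq_zero hφ hf hz hcrit n)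
  rw [evalAt_iter hφ hz hf, Function.iterate_succ_apply', hn, hf0]

end Commuting

/-! ### Embedding into `ℂ_p` and normalisation by the constant term -/

section Embedding

variable {p : ℕ} [Fact p.Prime] {K : Type*} [Field K] [Algebra ℚ_[p] K] [FiniteDimensional ℚ_[p] K]
  [Algebra ℤ_[p] K] [IsScalarTower ℤ_[p] ℚ_[p] K]

theorem norm_embedding_le_one (ι : K →ₐ[ℚ_[p]] ℂ_[p]) (x : ringOfIntegers p K) :
    ‖((ι : K →+* ℂ_[p]).comp (algebraMap (ringOfIntegers p K) K)) x‖ ≤ 1 :=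
  (norm_embedding p ι x.1).trans_le ((mem_ringOfIntegers_iff p x.1).1 x.2)

omit [FiniteDimensional ℚ_[p] K] [IsScalarTower ℤ_[p] ℚ_[p] K] in
theorem embedding_injective (ι : K →ₐ[ℚ_[p]] ℂ_[p]) :
    Function.Injective ((ι : K →+* ℂ_[p]).comp (algebraMap (ringOfIntegers p K) K)) :=
  ι.injective.comp Subtype.val_injective

theorem norm_embedding_lt_one (ι : K →ₐ[ℚ_[p]] ℂ_[p]) (x : ringOfIntegers p K)
    (hx : x ∈ IsLocalRing.maximalIdeal (ringOfIntegers p K)) :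
    ‖((ι : K →+* ℂ_[p]).comp (algebraMap (ringOfIntegers p K) K)) x‖ < 1 := by
  set φ := (ι : K →+* ℂ_[p]).comp (algebraMap (ringOfIntegers p K) K)
  refine (norm_embedding_le_one ι x).lt_of_ne fun h => ?_
  have h' : ‖ι x.1‖ = 1 := h
  have hx0 : x.1 ≠ 0 := fun h0 => by simp [h0] at h'
  have hinv : (x.1)⁻¹ ∈ ringOfIntegers p K := by
    rw [mem_ringOfIntegers_iff, ← norm_embedding p ι, map_inv₀, norm_inv, h', inv_one]
  exact hx (IsUnit.of_mul_eq_one ⟨_, hinv⟩ (Subtype.ext (mul_inv_cancel₀ hx0)))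

end Embedding

/-- A series is its constant term times a series in `1 + X · R⟦X⟧` exactly when this holds after
division by the constant term in a larger field. -/
theorem exists_C_inv_mul_map_iff {R K : Type*} [CommRing R] [Field K] {ψ : R →+* K}
    (hψ : Function.Injective ψ) {c : R} (hc : c ≠ 0) (g : R⟦X⟧) :
    (∃ h : R⟦X⟧, C ((ψ c)⁻¹) * PowerSeries.map ψ g = 1 + X * PowerSeries.map ψ h) ↔
      ∃ h : R⟦X⟧, g = C c * (1 + X * h) := by
  have hc' : ψ c ≠ 0 := (map_ne_zero_iff ψ hψ).2 hc
  refine exists_congr fun h => ⟨fun e => map_injective ψ hψ ?_, ?_⟩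
  · rw [map_mul, map_add, map_mul, map_one, map_X, map_C, ← e, ← mul_assoc, ← map_mul,
      mul_inv_cancel₀ hc', map_one, one_mul]
  · rintro rfl
    rw [map_mul, map_add, map_mul, map_one, map_X, map_C, ← mul_assoc, ← map_mul,
      inv_mul_cancel₀ hc', map_one, one_mul]

/-- A constant times a unit is its constant term times a series in `1 + X · R⟦X⟧`. -/
theorem exists_eq_C_mul_one_add_X_mul {R : Type*} [CommRing R] (a : R) {v : R⟦X⟧} (hv : IsUnit v) :
    ∃ h : R⟦X⟧, C a * v = C (constantCoeff (C a * v)) * (1 + X * h) := by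
  obtain ⟨b, hb⟩ := (hv.map constantCoeff).exists_right_inv
  have h0 : constantCoeff (C b * v - 1) = 0 := by
    rw [map_sub, map_mul, constantCoeff_C, mul_comm, hb, map_one, sub_self]
  obtain ⟨h, hh⟩ := X_dvd_iff.2 h0
  refine ⟨h, ?_⟩
  rw [← hh, add_sub_cancel, map_mul, constantCoeff_C, ← mul_assoc, ← map_mul, mul_assoc, hb,
    mul_one]

end LubinDynamics

theorem mainTheorem5 (p : ℕ) [Fact p.Prime] (K : Type*) [Field K] [Algebra ℚ_[p] K]
    [FiniteDimensional ℚ_[p] K] [Algebra ℤ_[p] K] [IsScalarTower ℤ_[p] ℚ_[p] K]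
    (ι : K →ₐ[ℚ_[p]] ℂ_[p])
    (f u : (LubinDynamics.ringOfIntegers p K)⟦X⟧)
    (hf : LubinDynamics.IsNoninvertible f) (hfs : LubinDynamics.IsStable f)
    (hfm : PowerSeries.map (IsLocalRing.residue (LubinDynamics.ringOfIntegers p K)) f ≠ 0)
    (hu : LubinDynamics.IsInvertible u) (hus : LubinDynamics.IsStable u)
    (hfu : LubinDynamics.comp f u = LubinDynamics.comp u f) :
    (∀ n : ℕ, 1 ≤ n → LubinDynamics.HasSimpleRoots
        ((ι : K →+* ℂ_[p]).comp (algebraMap (LubinDynamics.ringOfIntegers p K) K))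
        (LubinDynamics.iter f n)) ↔
      ∃ h : (LubinDynamics.ringOfIntegers p K)⟦X⟧,
        C ((algebraMap (LubinDynamics.ringOfIntegers p K) K (coeff 1 f))⁻¹) *
            PowerSeries.map (algebraMap (LubinDynamics.ringOfIntegers p K) K)
              (derivative (LubinDynamics.ringOfIntegers p K) f) =
          1 + X * PowerSeries.map (algebraMap (LubinDynamics.ringOfIntegers p K) K) h := by
  open LubinDynamics in
  have hφ := norm_embedding_le_one ι
  have hφm := norm_embedding_lt_one ι
  have hinj := embedding_injective ι
  -- The division by `f'(0)` takes place in `K`; clearing it gives an identity over `𝒪_K`.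
  rw [exists_C_inv_mul_map_iff Subtype.val_injective hfs.1]
  set φ := (ι : K →+* ℂ_[p]).comp (algebraMap (ringOfIntegers p K) K)
  constructor
  · intro hsimple
    have hdf : derivative (ringOfIntegers p K) f ≠ 0 := fun h =>
      hfs.1 (by rw [← constantCoeff_derivative, h, map_zero])
    obtain ⟨a, v, hv, e⟩ := exists_eq_C_mul_isUnit hφ hφm hdf fun z hz =>
      evalAt_derivative_ne_zero_of_hasSimpleRoots hφ hinj hf.1 (hφm _ hf.2) hfs.1 hu hus hfu
        hsimple hz
    rw [← constantCoeff_derivative, e]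
    exact exists_eq_C_mul_one_add_X_mul a hv
  · rintro ⟨h, e⟩ n - z ⟨hz, -⟩
    refine evalAt_derivative_iter_ne_zero hφ hf.1 (fun w hw => ?_) hz n
    rw [e, evalAt_mul hφ hw, evalAt_C]
    refine mul_ne_zero ((map_ne_zero_iff φ hinj).2 hfs.1) (evalAt_ne_zero_of_isUnit hφ hw ?_)
    simp [isUnit_iff_constantCoeff]
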